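/- Let $\mathcal X$ be a Polish space with its Borel $\sigma$-algebra, and let $\mathcal P$ and $\mathcal Q$ be nonempty convex sets of Borel probability measures on $\mathcal X$ that are compact in the topology of weak convergence. For probability measures $\mu,\nu$ put $\mathrm{KL}(\mu\,\|\,\nu)=\int_{\mathcal X}\log\frac{d\mu}{d\nu}\,d\mu\in[0,\infty]$ if $\mu\ll\nu$, and $\mathrm{KL}(\mu\,\|\,\nu)=+\infty$ otherwise. Define $$\mathrm{KL}(\mathcal P\,\|\,\mathcal Q)=\sup_{\mu\in\mathcal P}\ \inf_{\nu\in\mathcal Q}\ \mathrm{KL}(\mu\,\|\,\nu),\qquad \mathbb E^{\mathcal P}[f]=\sup_{\mu\in\mathcal P}\int_{\mathcal X} f\,d\mu,$$ and likewise $\mathbb E^{\mathcal Q}$, for bounded measurable $f:\mathcal X\to\mathbb R$. Then, as an equality in $[0,\infty]$, $$\mathrm{KL}(\mathcal P\,\|\,\mathcal Q)=\sup_{\varphi\in C_b(\mathcal X)}\left\{\mathbb E^{\mathcal P}[\varphi]-\log\left(\mathbb E^{\mathcal Q}\left[e^{\varphi}\right]\right)\right\},$$ where $C_b(\mathcal X)$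 is the space of bounded continuous real-valued functions on $\mathcal X$. -/

import Mathlib

open MeasureTheory
open scoped ENNReal NNReal BoundedContinuousFunction

/-- The generalized Kullback–Leibler divergence `KL(P ‖ Q) = sup_{μ ∈ P} inf_{ν ∈ Q} KL(μ ‖ ν)`
between two sets of probability measures, with values in `[0, ∞]`. For probability measures,
`InformationTheory.klDiv μ ν` is `∫ log (dμ/dν) dμ` if `μ ≪ ν` (which is `∞` when the integrand is
not integrable, its negative part being always integrable) and `∞` otherwise. -/
noncomputable def generalizedKL {X : Type*} [MeasurableSpace X]
    (P Q : Set (ProbabilityMeasure X)) : ℝ≥0∞ :=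
  ⨆ μ ∈ P, ⨅ ν ∈ Q, InformationTheory.klDiv (μ : Measure X) (ν : Measure X)

/-- The sublinear expectation `𝔼^P[f] = sup_{μ ∈ P} E_μ[f]`. It is a genuine real supremum
whenever `P` is nonempty and `f` is bounded and measurable. -/
noncomputable def sublinearExpectation {X : Type*} [MeasurableSpace X]
    (P : Set (ProbabilityMeasure X)) (f : X → ℝ) : ℝ :=
  ⨆ μ : P, ∫ x, f x ∂((μ : ProbabilityMeasure X) : Measure X)

/-- Convexity of a set of probability measures: convexity as a subset of the cone of finite
measures. -/
def IsConvexFamily {X : Type*} [MeasurableSpace X] (P : Set (ProbabilityMeasure X)) : Prop :=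
  Convex ℝ≥0 (ProbabilityMeasure.toFiniteMeasure '' P)

/-!
Fix `μ ∈ P`. Since only `𝔼^P[φ]` depends on `P`, and as a supremum over `μ ∈ P`, the formula
reduces to the one for a single `μ`, namely
`inf_{ν ∈ Q} KL(μ ‖ ν) = sup_φ (∫ φ dμ - log 𝔼^Q[exp φ])`.

The inequality `≥` is Gibbs' inequality for `μ` and the exponentially tilted measure `ν.tilted φ`
(`integral_sub_log_integral_exp_le_klDiv`).

For `≤`, the logarithm is linearised: the functional `F(ν, φ) = ∫ φ dμ - ∫ exp φ dν + 1` is affine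
and weakly continuous in `ν`, concave and norm continuous in `φ`, so Sion's minimax theorem on the
compact convex set `Q` exchanges `inf_ν` and `sup_φ`
(`iInf_iSup_le_iSup_iInf_integral_sub_integral_exp`). On one side,
`KL(μ ‖ ν) ≤ sup_φ F(ν, φ)`: the bound passes from bounded continuous to bounded measurable
functions by density in `L¹(μ + ν)` (`forall_measurable_of_forall_boundedContinuous`), and
logarithms of the clamped density `dμ/dν` recover the divergence
(`klDiv_le_of_forall_measurable`). On the other side, `log t ≤ t - 1` and the compactness of `Q`
give `inf_ν F(ν, φ) ≤ ∫ φ dμ - log 𝔼^Q[exp φ]` (`iInf_integral_sub_integral_exp_le`).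
-/

/-! ### The variational inequality for one pair of measures -/

section Variational

variable {X : Type*} [MeasurableSpace X]

theorem integral_sub_log_integral_exp_le_klDiv {μ ν : Measure X} [IsProbabilityMeasure μ]
    [IsProbabilityMeasure ν] {f : X → ℝ} (hfμ : Integrable f μ)
    (hfν : Integrable (fun x => Real.exp (f x)) ν) :
    ((∫ x, f x ∂μ - Real.log (∫ x, Real.exp (f x) ∂ν) : ℝ) : EReal)
      ≤ (InformationTheory.klDiv μ ν : EReal) := by
  by_cases htop : InformationTheory.klDiv μ ν = ∞
  · simp [htop]
  obtain ⟨hac, hint⟩ := InformationTheory.klDiv_ne_top_iff.mp htop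
  have hprob : IsProbabilityMeasure (ν.tilted f) := isProbabilityMeasure_tilted hfν
  have hac' : μ ≪ ν.tilted f := hac.trans (absolutelyContinuous_tilted hfν)
  have h := InformationTheory.integral_llr_add_sub_measure_univ_nonneg hac'
    (integrable_llr_tilted_right hac hfμ hint hfν)
  rw [integral_llr_tilted_right hac hfμ hfν hint] at h
  rw [← ENNReal.ofReal_toReal htop,
    InformationTheory.toReal_klDiv_of_measure_eq hac (by simp), EReal.coe_ennreal_ofReal]
  simp only [probReal_univ] at h
  refine EReal.coe_le_coe_iff.mpr (le_max_of_le_left ?_)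
  linarith

/-- The truncated Young inequality: clamping the optimiser `t = u` of `t ↦ u * log t - t + 1` to an
interval around `1` keeps the value nonnegative. -/
theorem mul_log_clamp_sub_add_one_nonneg {u a b : ℝ} (ha : 0 < a) (ha1 : a ≤ 1)
    (hb1 : 1 ≤ b) : 0 ≤ u * Real.log (max a (min u b)) - max a (min u b) + 1 := by
  set t := max a (min u b) with ht
  have ht0 : 0 < t := lt_of_lt_of_le ha (le_max_left _ _)
  have key : t - 1 ≤ t * Real.log t := by
    have h := Real.one_sub_inv_le_log_of_pos ht0
    have h2 := mul_le_mul_of_nonneg_left h ht0.le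
    rwa [mul_sub, mul_one, mul_inv_cancel₀ ht0.ne'] at h2
  have hmul : 0 ≤ (u - t) * Real.log t := by
    rcases le_total u 1 with h | h
    · have h1 : t = max a u := by rw [ht, min_eq_left (h.trans hb1)]
      have h2 : u ≤ t := h1 ▸ le_max_right _ _
      have h3 : t ≤ 1 := h1 ▸ max_le ha1 h
      exact mul_nonneg_of_nonpos_of_nonpos (by linarith) (Real.log_nonpos ht0.le h3)
    · have h1 : t = min u b := max_eq_right (ha1.trans (le_min h hb1))
      have h2 : t ≤ u := h1 ▸ min_le_left _ _
      have h3 : 1 ≤ t := h1 ▸ le_min h hb1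
      exact mul_nonneg (by linarith) (Real.log_nonneg h3)
  linarith

/-- If the linearised Donsker–Varadhan functional is bounded by `c` on bounded measurable functions,
then so is the divergence. Large multiples of the indicator of a `ν`-null set force `μ ≪ ν`;
logarithms of the clamped density then give the bound by Fatou's lemma. -/
theorem klDiv_le_of_forall_measurable {μ ν : Measure X} [IsProbabilityMeasure μ]
    [IsProbabilityMeasure ν] {c : ℝ}
    (h : ∀ g : X → ℝ, Measurable g → ∀ M : ℝ, (∀ x, |g x| ≤ M) →
      ∫ x, g x ∂μ - ∫ x, Real.exp (g x) ∂ν + 1 ≤ c) :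
    InformationTheory.klDiv μ ν ≤ ENNReal.ofReal c := by
  have hac : μ ≪ ν := by
    refine Measure.AbsolutelyContinuous.mk fun A hA hνA => ?_
    by_contra hμA
    have hpos : 0 < μ.real A := ENNReal.toReal_pos hμA (measure_ne_top μ A)
    obtain ⟨n, hn⟩ := exists_nat_gt (c / μ.real A)
    have h1 := h (A.indicator fun _ => (n : ℝ)) (measurable_const.indicator hA) n (fun x => by
      by_cases hx : x ∈ A <;> simp [hx])
    have h2 : ∫ x, Real.exp (A.indicator (fun _ => (n : ℝ)) x) ∂ν = 1 := by
      have hae : (fun x => Real.exp (A.indicator (fun _ => (n : ℝ)) x)) =ᵐ[ν] fun _ => (1 : ℝ) := by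
        filter_upwards [measure_eq_zero_iff_ae_notMem.mp hνA] with x hx
        simp [hx]
      rw [integral_congr_ae hae]
      simp
    rw [h2, integral_indicator_const _ hA, smul_eq_mul] at h1
    rw [div_lt_iff₀ hpos] at hn
    linarith
  set f : X → ℝ := fun x => (μ.rnDeriv ν x).toReal
  have hfm : Measurable f := (Measure.measurable_rnDeriv μ ν).ennreal_toReal
  have hf0 : ∀ x, 0 ≤ f x := fun x => ENNReal.toReal_nonneg
  have hfint : Integrable f ν := Measure.integrable_toReal_rnDeriv
  let t : ℕ → X → ℝ := fun n x => max ((n + 1 : ℝ)⁻¹) (min (f x) ((n : ℝ) + 1))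
  have hinv : ∀ n : ℕ, 0 < (n + 1 : ℝ)⁻¹ ∧ (n + 1 : ℝ)⁻¹ ≤ 1 ∧ (1 : ℝ) ≤ n + 1 := fun n => by
    have : (1 : ℝ) ≤ n + 1 := by linarith [n.cast_nonneg (α := ℝ)]
    exact ⟨by positivity, inv_le_one_of_one_le₀ this, this⟩
  have htm : ∀ n, Measurable (t n) := fun n =>
    measurable_const.max (hfm.min measurable_const)
  have ht1 : ∀ (n : ℕ) x, (n + 1 : ℝ)⁻¹ ≤ t n x := fun n x => le_max_left _ _
  have ht2 : ∀ (n : ℕ) x, t n x ≤ n + 1 := fun n x =>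
    max_le ((hinv n).2.1.trans (hinv n).2.2) (min_le_right _ _)
  have ht0 : ∀ n x, 0 < t n x := fun n x => (hinv n).1.trans_le (ht1 n x)
  have hlog : ∀ (n : ℕ) x, |Real.log (t n x)| ≤ Real.log (n + 1) := fun n x => by
    have a1 := Real.log_le_log (hinv n).1 (ht1 n x)
    have a2 := Real.log_le_log (ht0 n x) (ht2 n x)
    rw [Real.log_inv] at a1
    exact abs_le.mpr ⟨a1, a2⟩
  let H : ℕ → X → ℝ := fun n x => f x * Real.log (t n x) - t n x + 1
  have hH0 : ∀ n x, 0 ≤ H n x := fun n x =>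
    mul_log_clamp_sub_add_one_nonneg (hinv n).1 (hinv n).2.1 (hinv n).2.2
  have hlm : ∀ n, Measurable fun x => Real.log (t n x) := fun n => (htm n).log
  have hflint : ∀ n, Integrable (fun x => f x * Real.log (t n x)) ν := fun n =>
    hfint.mul_bdd (c := Real.log (n + 1)) (hlm n).aestronglyMeasurable (ae_of_all _ (hlog n))
  have htint : ∀ n, Integrable (t n) ν := fun n =>
    Integrable.of_bound (htm n).aestronglyMeasurable (n + 1)
      (ae_of_all _ fun x => by rw [Real.norm_of_nonneg (ht0 n x).le]; exact ht2 n x)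
  have hHint : ∀ n, Integrable (H n) ν := fun n =>
    ((hflint n).sub (htint n)).add (integrable_const _)
  have hHle : ∀ n, ∫ x, H n x ∂ν ≤ c := fun n => by
    have h1 := h (fun x => Real.log (t n x)) (hlm n) _ (hlog n)
    have h2 : ∫ x, Real.log (t n x) ∂μ = ∫ x, f x * Real.log (t n x) ∂ν := by
      rw [← integral_rnDeriv_smul hac]
      rfl
    have h3 : ∫ x, H n x ∂ν = ∫ x, f x * Real.log (t n x) ∂ν - ∫ x, t n x ∂ν + 1 := by
      have := integral_add ((hflint n).sub (htint n)) (integrable_const (μ := ν) (1 : ℝ))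
      simp only [Pi.sub_apply] at this
      rw [integral_sub (hflint n) (htint n)] at this
      simpa using this
    simp only [Real.exp_log (ht0 n _)] at h1
    rw [h3, ← h2]
    exact h1
  -- Where `f x ≠ 0` the clamping eventually has no effect; where `f x = 0` the value is
  -- `1 - (n + 1)⁻¹`, which tends to `klFun 0 = 1`.
  have hlim : ∀ x, Filter.Tendsto (fun n => H n x) Filter.atTop
      (nhds (InformationTheory.klFun (f x))) := fun x => by
    have hinv0 : Filter.Tendsto (fun n : ℕ => (n + 1 : ℝ)⁻¹) Filter.atTop (nhds 0) := by
      simpa using tendsto_one_div_add_atTop_nhds_zero_nat (𝕜 := ℝ)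
    rcases (hf0 x).eq_or_lt with hx | hx
    · have : ∀ n : ℕ, H n x = 1 - (n + 1 : ℝ)⁻¹ := fun n => by
        have h1 : t n x = (n + 1 : ℝ)⁻¹ := by
          simp only [t, ← hx]
          rw [min_eq_left (by positivity), max_eq_left (hinv n).1.le]
        simp only [H, h1, ← hx]
        ring
      simp only [this, ← hx, InformationTheory.klFun_zero]
      simpa using hinv0.const_sub 1
    · refine tendsto_const_nhds.congr' ?_
      filter_upwards [hinv0.eventually_lt_const hx,
        (tendsto_natCast_atTop_atTop (R := ℝ)).eventually_ge_atTop (f x)] with n h1 h2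
      have : t n x = f x := by
        simp only [t]
        rw [min_eq_left (by linarith), max_eq_right h1.le]
      simp only [H, this, InformationTheory.klFun]
      ring
  rw [InformationTheory.klDiv_eq_lintegral_klFun_of_ac hac]
  calc ∫⁻ x, ENNReal.ofReal (InformationTheory.klFun (f x)) ∂ν
      = ∫⁻ x, Filter.liminf (fun n => ENNReal.ofReal (H n x)) Filter.atTop ∂ν :=
        lintegral_congr fun x => ((ENNReal.tendsto_ofReal (hlim x)).liminf_eq).symm
    _ ≤ Filter.liminf (fun n => ∫⁻ x, ENNReal.ofReal (H n x) ∂ν) Filter.atTop :=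
        lintegral_liminf_le fun n =>
          (((hfm.mul (hlm n)).sub (htm n)).add measurable_const).ennreal_ofReal
    _ ≤ ENNReal.ofReal c := by
        refine Filter.liminf_le_of_le (by isBoundedDefault) fun b hb => ?_
        obtain ⟨n, hn⟩ := hb.exists
        refine hn.trans ?_
        rw [← ofReal_integral_eq_lintegral_ofReal (hHint n) (ae_of_all _ (hH0 n))]
        exact ENNReal.ofReal_le_ofReal (hHle n)

variable [TopologicalSpace X] [BorelSpace X]

theorem integrable_exp_boundedContinuous (ν : Measure X) [IsFiniteMeasure ν] (φ : X →ᵇ ℝ) :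
    Integrable (fun x => Real.exp (φ x)) ν :=
  Integrable.of_bound (Real.continuous_exp.comp φ.continuous).measurable.aestronglyMeasurable
    (Real.exp ‖φ‖) (ae_of_all _ fun x => by
      rw [Real.norm_of_nonneg (Real.exp_pos _).le]
      exact Real.exp_le_exp.mpr ((le_abs_self _).trans (φ.norm_coe_le_norm x)))

/-- Bounded measurable functions are approximated by bounded continuous ones in `L¹(μ + ν)`; a
truncation keeps the approximants uniformly bounded, so that their exponentials converge too. -/
theorem forall_measurable_of_forall_boundedContinuous [T4Space X] {μ ν : Measure X}
    [IsProbabilityMeasure μ] [IsProbabilityMeasure ν] [(μ + ν).WeaklyRegular] {c : ℝ}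
    (h : ∀ φ : X →ᵇ ℝ, ∫ x, φ x ∂μ - ∫ x, Real.exp (φ x) ∂ν + 1 ≤ c)
    {g : X → ℝ} (hg : Measurable g) {M : ℝ} (hM : ∀ x, |g x| ≤ M) :
    ∫ x, g x ∂μ - ∫ x, Real.exp (g x) ∂ν + 1 ≤ c := by
  have hM0 : 0 ≤ M := by
    obtain ⟨x⟩ : Nonempty X := nonempty_of_isProbabilityMeasure μ
    exact (abs_nonneg _).trans (hM x)
  have hgint : ∀ (m : Measure X) [IsFiniteMeasure m], Integrable g m := fun m _ =>
    Integrable.of_bound hg.aestronglyMeasurable M (ae_of_all _ hM)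
  have hexpint : Integrable (fun x => Real.exp (g x)) ν :=
    Integrable.of_bound hg.exp.aestronglyMeasurable (Real.exp M) (ae_of_all _ fun x => by
      rw [Real.norm_of_nonneg (Real.exp_pos _).le]
      exact Real.exp_le_exp.mpr ((le_abs_self _).trans (hM x)))
  refine le_of_forall_pos_le_add fun ε hε => ?_
  -- `1` and `exp M` are the Lipschitz constants of the two integrands on `[-M, M]`.
  set K : ℝ := 1 + Real.exp M with hK
  have hKpos : 0 < K := by positivity
  obtain ⟨ψ, hψ, -⟩ := (hgint (μ + ν)).exists_boundedContinuous_integral_sub_le (div_pos hε hKpos)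
  let φ : X →ᵇ ℝ := BoundedContinuousFunction.ofNormedAddCommGroup
    (fun x => max (-M) (min (ψ x) M)) (continuous_const.max (ψ.continuous.min continuous_const)) M
    (fun x => abs_le.mpr ⟨le_max_left _ _, max_le (by linarith) (min_le_right _ _)⟩)
  have hφ : ∀ x, φ x = max (-M) (min (ψ x) M) := fun x => rfl
  have hφM : ∀ x, φ x ≤ M := fun x => by
    rw [hφ]; exact max_le (by linarith) (min_le_right _ _)
  -- Truncation to `[-M, M]` is `1`-Lipschitz and fixes `g`.
  have hdist : ∀ x, |g x - φ x| ≤ |g x - ψ x| := fun x => by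
    have h1 : g x = max (-M) (min (g x) M) := by
      rw [min_eq_left (abs_le.mp (hM x)).2, max_eq_right (abs_le.mp (hM x)).1]
    conv_lhs => rw [h1, hφ]
    refine (abs_max_sub_max_le_max _ _ _ _).trans ?_
    rw [sub_self, abs_zero, max_eq_right (abs_nonneg _)]
    refine (abs_min_sub_min_le_max _ _ _ _).trans ?_
    rw [sub_self, abs_zero, max_eq_left (abs_nonneg _)]
  have hexp : ∀ x, Real.exp (φ x) - Real.exp (g x) ≤ Real.exp M * |g x - φ x| := fun x => by
    have h1 : Real.exp (φ x) - Real.exp (g x) ≤ Real.exp (φ x) * (φ x - g x) := by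
      have h2 := Real.add_one_le_exp (g x - φ x)
      have h3 := mul_le_mul_of_nonneg_left h2 (Real.exp_pos (φ x)).le
      rw [← Real.exp_add, add_sub_cancel] at h3
      linarith
    calc _ ≤ Real.exp (φ x) * (φ x - g x) := h1
      _ ≤ Real.exp (φ x) * |g x - φ x| := by
        rw [abs_sub_comm]
        exact mul_le_mul_of_nonneg_left (le_abs_self _) (Real.exp_pos _).le
      _ ≤ _ := mul_le_mul_of_nonneg_right (Real.exp_le_exp.mpr (hφM x)) (abs_nonneg _)
  have hdint : ∀ (m : Measure X) [IsFiniteMeasure m], Integrable (fun x => |g x - φ x|) m :=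
    fun m _ => ((hgint m).sub (φ.integrable m)).abs
  have hsum : ∫ x, |g x - φ x| ∂μ + ∫ x, |g x - φ x| ∂ν ≤ ε / K := by
    rw [← integral_add_measure (hdint μ) (hdint ν)]
    exact (integral_mono (hdint _) ((hgint _).sub (ψ.integrable _)).abs hdist).trans hψ
  have i1 : ∫ x, g x ∂μ - ∫ x, φ x ∂μ ≤ ∫ x, |g x - φ x| ∂μ := by
    rw [← integral_sub (hgint μ) (φ.integrable μ)]
    exact integral_mono ((hgint μ).sub (φ.integrable μ)) (hdint μ) fun x => le_abs_self _
  have i2 : ∫ x, Real.exp (φ x) ∂ν - ∫ x, Real.exp (g x) ∂ν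
      ≤ Real.exp M * ∫ x, |g x - φ x| ∂ν := by
    rw [← integral_sub (integrable_exp_boundedContinuous ν φ) hexpint, ← integral_const_mul]
    exact integral_mono ((integrable_exp_boundedContinuous ν φ).sub hexpint)
      ((hdint ν).const_mul _) hexp
  have n1 : 0 ≤ ∫ x, |g x - φ x| ∂μ := integral_nonneg fun x => abs_nonneg _
  have n2 : 0 ≤ ∫ x, |g x - φ x| ∂ν := integral_nonneg fun x => abs_nonneg _
  have hKε : K * (∫ x, |g x - φ x| ∂μ + ∫ x, |g x - φ x| ∂ν) ≤ ε := by
    rw [mul_comm]; exact (le_div_iff₀ hKpos).mp hsum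
  have hE : 0 ≤ Real.exp M * ∫ x, |g x - φ x| ∂μ := mul_nonneg (Real.exp_pos _).le n1
  rw [hK] at hKε
  linarith [h φ]

theorem klDiv_le_iSup_boundedContinuous [T4Space X] (μ ν : Measure X)
    [IsProbabilityMeasure μ] [IsProbabilityMeasure ν] [(μ + ν).WeaklyRegular] :
    (InformationTheory.klDiv μ ν : EReal)
      ≤ ⨆ φ : X →ᵇ ℝ, ((∫ x, φ x ∂μ - ∫ x, Real.exp (φ x) ∂ν + 1 : ℝ) : EReal) := by
  refine EReal.le_of_forall_lt_iff_le.mp fun c hc => ?_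
  have h : ∀ φ : X →ᵇ ℝ, ∫ x, φ x ∂μ - ∫ x, Real.exp (φ x) ∂ν + 1 ≤ c := fun φ =>
    EReal.coe_le_coe_iff.mp ((le_iSup (fun φ : X →ᵇ ℝ =>
      ((∫ x, φ x ∂μ - ∫ x, Real.exp (φ x) ∂ν + 1 : ℝ) : EReal)) φ).trans hc.le)
  have hc0 : 0 ≤ c := by simpa using h 0
  have := klDiv_le_of_forall_measurable fun g hg M hM =>
    forall_measurable_of_forall_boundedContinuous h hg hM
  refine (EReal.coe_ennreal_le_coe_ennreal_iff.mpr this).trans ?_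
  rw [EReal.coe_ennreal_ofReal, max_eq_left hc0]

end Variational

/-! ### Exchange of infimum and supremum -/

section Minimax

variable {X : Type*} [TopologicalSpace X] [MeasurableSpace X] [BorelSpace X]

/-- The exponential of a bounded continuous function, as a bounded continuous function. -/
noncomputable def expBoundedContinuous (φ : X →ᵇ ℝ) : X →ᵇ ℝ :=
  BoundedContinuousFunction.ofNormedAddCommGroup (fun x => Real.exp (φ x))
    (Real.continuous_exp.comp φ.continuous) (Real.exp ‖φ‖) fun x => by
      rw [Real.norm_of_nonneg (Real.exp_pos _).le]
      exact Real.exp_le_exp.mpr ((le_abs_self _).trans (φ.norm_coe_le_norm x))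

/-- A probability measure as the family of its integrals of bounded continuous functions. This
places sets of probability measures in a real topological vector space. -/
noncomputable def integralFamily (ν : ProbabilityMeasure X) : (X →ᵇ ℝ) → ℝ :=
  fun φ => ∫ x, φ x ∂(ν : Measure X)

theorem continuous_integral_boundedContinuous (φ : X →ᵇ ℝ) :
    Continuous fun ν : ProbabilityMeasure X => ∫ x, φ x ∂(ν : Measure X) :=
  continuous_iff_continuousAt.mpr fun _ =>
    ProbabilityMeasure.tendsto_iff_forall_integral_tendsto.mp Filter.tendsto_id φ

theorem continuous_integralFamily : Continuous (integralFamily (X := X)) :=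
  continuous_pi continuous_integral_boundedContinuous

theorem IsConvexFamily.convex_image_integralFamily {Q : Set (ProbabilityMeasure X)}
    (hQ : IsConvexFamily Q) : Convex ℝ (integralFamily '' Q) := by
  rintro _ ⟨ν₁, h₁, rfl⟩ _ ⟨ν₂, h₂, rfl⟩ a b ha hb hab
  lift a to ℝ≥0 using ha
  lift b to ℝ≥0 using hb
  obtain ⟨ν, hν, hνeq⟩ := hQ (Set.mem_image_of_mem _ h₁) (Set.mem_image_of_mem _ h₂)
    zero_le zero_le (by exact_mod_cast hab)
  refine ⟨ν, hν, funext fun φ => ?_⟩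
  have hm : (ν : Measure X) = a • (ν₁ : Measure X) + b • (ν₂ : Measure X) := by
    have := congrArg (fun m : FiniteMeasure X => (m : Measure X)) hνeq
    simpa using this
  simp only [integralFamily, Pi.add_apply, Pi.smul_apply, hm]
  rw [integral_add_measure ((φ.integrable _).smul_measure_nnreal)
    ((φ.integrable _).smul_measure_nnreal), integral_smul_nnreal_measure,
    integral_smul_nnreal_measure]
  rfl

theorem continuous_integral_comp (ν : Measure X) [IsFiniteMeasure ν] {h : ℝ → ℝ}
    (hh : Continuous h) : Continuous fun φ : X →ᵇ ℝ => ∫ x, h (φ x) ∂ν := by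
  refine continuous_iff_continuousAt.mpr fun φ₀ => ?_
  obtain ⟨C, hC⟩ := (isCompact_Icc (a := -(‖φ₀‖ + 1)) (b := ‖φ₀‖ + 1)).exists_bound_of_continuousOn
    hh.continuousOn
  refine continuousAt_of_dominated (bound := fun _ => C)
    (.of_forall fun φ => (hh.comp φ.continuous).measurable.aestronglyMeasurable) ?_
    (integrable_const _) (ae_of_all _ fun x =>
      (hh.comp (BoundedContinuousFunction.lipschitz_eval_const x).continuous).continuousAt)
  filter_upwards [continuous_norm.continuousAt.eventually_lt_const (lt_add_one ‖φ₀‖)] with φ hφ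
  exact ae_of_all _ fun x => hC _ (abs_le.mp ((φ.norm_coe_le_norm x).trans hφ.le))

theorem concaveOn_integral_sub_integral_exp (μ ν : Measure X) [IsFiniteMeasure μ]
    [IsFiniteMeasure ν] :
    ConcaveOn ℝ Set.univ
      fun φ : X →ᵇ ℝ => ∫ x, φ x ∂μ - ∫ x, Real.exp (φ x) ∂ν + 1 := by
  refine ⟨convex_univ, fun φ _ ψ _ a b ha hb hab => ?_⟩
  have h1 : ∫ x, (a • φ + b • ψ) x ∂μ = a * ∫ x, φ x ∂μ + b * ∫ x, ψ x ∂μ := by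
    rw [← integral_const_mul, ← integral_const_mul,
      ← integral_add ((φ.integrable μ).const_mul a) ((ψ.integrable μ).const_mul b)]
    rfl
  have e1 := (integrable_exp_boundedContinuous ν φ).const_mul a
  have e2 := (integrable_exp_boundedContinuous ν ψ).const_mul b
  have h2 : ∫ x, Real.exp ((a • φ + b • ψ) x) ∂ν
      ≤ a * ∫ x, Real.exp (φ x) ∂ν + b * ∫ x, Real.exp (ψ x) ∂ν := by
    rw [← integral_const_mul, ← integral_const_mul, ← integral_add e1 e2]
    exact integral_mono (integrable_exp_boundedContinuous ν _) (e1.add e2) fun x =>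
      convexOn_exp.2 (Set.mem_univ (φ x)) (Set.mem_univ (ψ x)) ha hb hab
  simp only [smul_eq_mul, h1]
  linear_combination h2 + hab

/-- Sion's theorem for the linearised functional, with `Q` replaced by its compact convex image in
`(X →ᵇ ℝ) → ℝ`, on which the functional is affine in the first variable. -/
theorem iInf_iSup_le_iSup_iInf_integral_sub_integral_exp (μ : Measure X) [IsFiniteMeasure μ]
    {Q : Set (ProbabilityMeasure X)} (hQ_nonempty : Q.Nonempty) (hQ_compact : IsCompact Q)
    (hQ_convex : IsConvexFamily Q) :
    ⨅ ν ∈ Q, ⨆ φ : X →ᵇ ℝ,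
        ((∫ x, φ x ∂μ - ∫ x, Real.exp (φ x) ∂(ν : Measure X) + 1 : ℝ) : EReal)
      ≤ ⨆ φ : X →ᵇ ℝ, ⨅ ν ∈ Q,
        ((∫ x, φ x ∂μ - ∫ x, Real.exp (φ x) ∂(ν : Measure X) + 1 : ℝ) : EReal) := by
  have hmono : Monotone Real.toEReal := EReal.coe_strictMono.monotone
  have key := Sion.minimax' (X := integralFamily '' Q) (Y := (Set.univ : Set (X →ᵇ ℝ)))
    (f := fun L φ => ((∫ x, φ x ∂μ - L (expBoundedContinuous φ) + 1 : ℝ) : EReal))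
    (hQ_nonempty.image _) hQ_convex.convex_image_integralFamily
    (hQ_compact.image continuous_integralFamily)
    (fun φ _ => by
      refine Continuous.lowerSemicontinuous (continuous_coe_real_ereal.comp ?_)
        |>.lowerSemicontinuousOn _
      fun_prop)
    (fun φ _ => by
      refine (ConvexOn.quasiconvexOn (f := fun L : (X →ᵇ ℝ) → ℝ =>
        ∫ x, φ x ∂μ - L (expBoundedContinuous φ) + 1) ?_).monotone_comp (g := Real.toEReal) hmono
      refine ⟨hQ_convex.convex_image_integralFamily, fun L _ L' _ a b _ _ hab => ?_⟩
      simp only [Pi.add_apply, Pi.smul_apply, smul_eq_mul]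
      linear_combination (-(∫ x, φ x ∂μ) - 1) * hab)
    convex_univ
    (by
      rintro _ ⟨ν, -, rfl⟩
      refine Continuous.upperSemicontinuous (continuous_coe_real_ereal.comp ?_)
        |>.upperSemicontinuousOn _
      exact ((continuous_integral_comp μ continuous_id).sub
        (continuous_integral_comp (ν : Measure X) Real.continuous_exp)).add continuous_const)
    (by
      rintro _ ⟨ν, -, rfl⟩
      exact (concaveOn_integral_sub_integral_exp μ (ν : Measure X)).quasiconcaveOn.monotone_comp
        (g := Real.toEReal) hmono)
  simp only [iInf_image, Set.mem_univ, iSup_pos] at key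
  exact key.le

end Minimax

/-! ### The duality formula -/

section Duality

variable {X : Type*} [TopologicalSpace X] [MeasurableSpace X] [BorelSpace X]

theorem bddAbove_range_integral_exp (Q : Set (ProbabilityMeasure X)) (φ : X →ᵇ ℝ) :
    BddAbove (Set.range fun ν : Q =>
      ∫ x, Real.exp (φ x) ∂((ν : ProbabilityMeasure X) : Measure X)) := by
  refine ⟨Real.exp ‖φ‖, ?_⟩
  rintro _ ⟨ν, rfl⟩
  refine (integral_mono (integrable_exp_boundedContinuous _ φ) (integrable_const (Real.exp ‖φ‖))
    fun x => Real.exp_le_exp.mpr ((le_abs_self _).trans (φ.norm_coe_le_norm x))).trans ?_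
  simp

theorem bddAbove_range_integral (P : Set (ProbabilityMeasure X)) (φ : X →ᵇ ℝ) :
    BddAbove (Set.range fun μ : P => ∫ x, φ x ∂((μ : ProbabilityMeasure X) : Measure X)) := by
  refine ⟨‖φ‖, ?_⟩
  rintro _ ⟨μ, rfl⟩
  refine (integral_mono (φ.integrable _) (integrable_const ‖φ‖)
    fun x => (le_abs_self _).trans (φ.norm_coe_le_norm x)).trans ?_
  simp

theorem EReal.toENNReal_le_iff {x : EReal} {y : ℝ≥0∞} : x.toENNReal ≤ y ↔ x ≤ (y : EReal) := by
  refine ⟨fun h => ?_, fun h => by simpa using EReal.toENNReal_le_toENNReal h⟩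
  refine le_trans ?_ (EReal.coe_ennreal_le_coe_ennreal_iff.mpr h)
  rw [EReal.coe_toENNReal_eq_max]
  exact le_max_right _ _

theorem integral_sub_log_sublinearExpectation_le_iInf_klDiv (μ : ProbabilityMeasure X)
    (Q : Set (ProbabilityMeasure X)) (φ : X →ᵇ ℝ) :
    ((∫ x, φ x ∂(μ : Measure X)
        - Real.log (sublinearExpectation Q fun x => Real.exp (φ x)) : ℝ) : EReal)
      ≤ ((⨅ ν ∈ Q, InformationTheory.klDiv (μ : Measure X) (ν : Measure X) : ℝ≥0∞) : EReal) := by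
  refine EReal.toENNReal_le_iff.mp (le_iInf₂ fun ν hν => EReal.toENNReal_le_iff.mpr ?_)
  refine le_trans (EReal.coe_le_coe_iff.mpr (sub_le_sub_left ?_ _))
    (integral_sub_log_integral_exp_le_klDiv (φ.integrable _) (integrable_exp_boundedContinuous _ φ))
  exact Real.log_le_log (integral_exp_pos (integrable_exp_boundedContinuous _ φ))
    (le_ciSup (bddAbove_range_integral_exp Q φ) ⟨ν, hν⟩)

/-- The infimum over `Q` of the linearised functional at `φ` is attained by compactness, and
`log t ≤ t - 1` at the value of `𝔼^Q[exp φ]`. -/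
theorem iInf_integral_sub_integral_exp_le {Q : Set (ProbabilityMeasure X)}
    (hQ_nonempty : Q.Nonempty) (hQ_compact : IsCompact Q) (a : ℝ) (φ : X →ᵇ ℝ) :
    ⨅ ν ∈ Q, ((a - ∫ x, Real.exp (φ x) ∂(ν : Measure X) + 1 : ℝ) : EReal)
      ≤ ((a - Real.log (sublinearExpectation Q fun x => Real.exp (φ x)) : ℝ) : EReal) := by
  obtain ⟨ν, hν, hmax⟩ := hQ_compact.exists_isMaxOn hQ_nonempty
    (continuous_integral_boundedContinuous (expBoundedContinuous φ)).continuousOn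
  have hle : sublinearExpectation Q (fun x => Real.exp (φ x))
      = ∫ x, Real.exp (φ x) ∂(ν : Measure X) := by
    have : Nonempty Q := ⟨⟨ν, hν⟩⟩
    exact le_antisymm (ciSup_le fun ν' => hmax ν'.2)
      (le_ciSup (bddAbove_range_integral_exp Q φ) ⟨ν, hν⟩)
  refine (iInf₂_le ν hν).trans (EReal.coe_le_coe_iff.mpr ?_)
  have hpos : 0 < ∫ x, Real.exp (φ x) ∂(ν : Measure X) :=
    integral_exp_pos (integrable_exp_boundedContinuous _ φ)
  rw [hle]
  linarith [Real.log_le_sub_one_of_pos hpos]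

end Duality

theorem mainTheorem1 {X : Type*} [TopologicalSpace X] [PolishSpace X] [MeasurableSpace X]
    [BorelSpace X] (P Q : Set (ProbabilityMeasure X))
    (hP_nonempty : P.Nonempty) (hP_compact : IsCompact P) (hP_convex : IsConvexFamily P)
    (hQ_nonempty : Q.Nonempty) (hQ_compact : IsCompact Q) (hQ_convex : IsConvexFamily Q) :
    (generalizedKL P Q : EReal) =
      ⨆ φ : X →ᵇ ℝ,
        ((sublinearExpectation P φ
          - Real.log (sublinearExpectation Q (fun x => Real.exp (φ x))) : ℝ) : EReal) := by
  have : Nonempty P := hP_nonempty.to_subtype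
  have : Nonempty Q := hQ_nonempty.to_subtype
  set S : EReal := ⨆ φ : X →ᵇ ℝ, ((sublinearExpectation P φ
    - Real.log (sublinearExpectation Q (fun x => Real.exp (φ x))) : ℝ) : EReal)
  apply le_antisymm
  · -- The value at `φ = 0` shows that the right-hand side is nonnegative.
    have hS0 : 0 ≤ S := by
      refine le_trans (le_of_eq ?_) (le_iSup _ (0 : X →ᵇ ℝ))
      simp [sublinearExpectation]
    rw [← EReal.coe_toENNReal hS0, EReal.coe_ennreal_le_coe_ennreal_iff]
    refine iSup₂_le fun μ hμ => ?_
    rw [← EReal.coe_ennreal_le_coe_ennreal_iff, EReal.coe_toENNReal hS0]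
    calc ((⨅ ν ∈ Q, InformationTheory.klDiv (μ : Measure X) (ν : Measure X) : ℝ≥0∞) : EReal)
        ≤ ⨅ ν ∈ Q, ⨆ φ : X →ᵇ ℝ, ((∫ x, φ x ∂(μ : Measure X)
            - ∫ x, Real.exp (φ x) ∂(ν : Measure X) + 1 : ℝ) : EReal) :=
          le_iInf₂ fun ν hν => (EReal.coe_ennreal_le_coe_ennreal_iff.mpr (iInf₂_le ν hν)).trans
            (klDiv_le_iSup_boundedContinuous _ _)
      _ ≤ ⨆ φ : X →ᵇ ℝ, ⨅ ν ∈ Q, ((∫ x, φ x ∂(μ : Measure X)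
            - ∫ x, Real.exp (φ x) ∂(ν : Measure X) + 1 : ℝ) : EReal) :=
          iInf_iSup_le_iSup_iInf_integral_sub_integral_exp _ hQ_nonempty hQ_compact hQ_convex
      _ ≤ S := iSup_mono fun φ =>
          (iInf_integral_sub_integral_exp_le hQ_nonempty hQ_compact _ φ).trans
            (EReal.coe_le_coe_iff.mpr (sub_le_sub_right
              (le_ciSup (bddAbove_range_integral P φ) ⟨μ, hμ⟩) _))
  · refine iSup_le fun φ => ?_
    by_cases htop : generalizedKL P Q = ∞
    · simp [htop]
    rw [← ENNReal.ofReal_toReal htop, EReal.coe_ennreal_ofReal,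
      max_eq_left ENNReal.toReal_nonneg, EReal.coe_le_coe_iff, sub_le_iff_le_add]
    refine ciSup_le fun μ => ?_
    rw [← sub_le_iff_le_add, ← EReal.coe_le_coe_iff, ← max_eq_left ENNReal.toReal_nonneg,
      ← EReal.coe_ennreal_ofReal, ENNReal.ofReal_toReal htop]
    exact (integral_sub_log_sublinearExpectation_le_iInf_klDiv μ.1 Q φ).trans
      (EReal.coe_ennreal_le_coe_ennreal_iff.mpr (le_iSup₂
        (f := fun (μ : ProbabilityMeasure X) (_ : μ ∈ P) =>
          ⨅ ν ∈ Q, InformationTheory.klDiv (μ : Measure X) (ν : Measure X)) μ.1 μ.2))
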